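/- Let $B>0$. There is a constant $c_3>0$ depending only on $B$ such that the following holds. Let $X_0,X_1,X_2,\dots$ be independent real random variables on a probability space with $$\mathbb{E}X_j=0,\qquad \mathbb{E}X_j^2=1,\qquad \mathbb{E}|X_j|\ge B\qquad\text{for every } j\ge 0,$$ and for $n\ge 2$ let $T_n=\big[X_{|j-k|}\big]_{1\le j,k\le n}$ be the associated $n\times n$ random symmetric Toeplitz matrix, with spectral norm $\|T_n\|$ (its operator norm on Euclidean space; equivalently, the maximum absolute value of an eigenvalue of $T_n$). Then for every $n\ge 2$, $\|T_n\|$ is integrable and $$\mathbb{E}\|T_n\|\ \ge\ c_3\sqrt{n\log n}.$$ -/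

import Mathlib

/-- The `n × n` symmetric Toeplitz matrix `[a_{|j-k|}]_{j,k}` of a sequence `a_0, a_1, a_2, …`. -/
def symToeplitz (n : ℕ) (a : ℕ → ℝ) : Matrix (Fin n) (Fin n) ℝ :=
  Matrix.of fun j k => a ((j : ℤ) - (k : ℤ)).natAbs

/-- The spectral norm of a square real matrix: its operator norm on Euclidean space. -/
noncomputable def specNorm {n : ℕ} (A : Matrix (Fin n) (Fin n) ℝ) : ℝ :=
  ‖Matrix.toEuclideanCLM (n := Fin n) (𝕜 := ℝ) A‖

/-- For a symmetric real matrix, the spectral norm is the maximum absolute value of an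
eigenvalue. -/
theorem isGreatest_specNorm {n : ℕ} (hn : 0 < n) (A : Matrix (Fin n) (Fin n) ℝ)
    (hA : A.IsSymm) :
    IsGreatest {r : ℝ | ∃ μ : ℝ, Module.End.HasEigenvalue (Matrix.toLin' A) μ ∧ r = |μ|}
      (specNorm A) := by
  have : Nonempty (Fin n) := ⟨⟨0, hn⟩⟩
  have hH : A.IsHermitian := by
    rw [Matrix.IsHermitian, Matrix.conjTranspose_eq_transpose_of_trivial]; exact hA
  have hnorm : specNorm A = ‖hH.eigenvalues‖ := by
    open scoped Matrix.Norms.L2Operator in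
    have h : ‖A‖ = ‖hH.eigenvalues‖ := by
      conv_lhs => rw [hH.spectral_theorem]
      rw [Unitary.conjStarAlgAut_apply, ← Unitary.coe_star,
        CStarRing.norm_mul_coe_unitary, CStarRing.norm_coe_unitary_mul,
        Matrix.l2_opNorm_diagonal]
      rfl
    exact h
  have key : ∀ μ : ℝ, Module.End.HasEigenvalue (Matrix.toLin' A) μ ↔
      ∃ i, hH.eigenvalues i = μ := by
    intro μ
    rw [Module.End.hasEigenvalue_iff_mem_spectrum, Matrix.spectrum_toLin',
      hH.spectrum_real_eq_range_eigenvalues]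
    rfl
  constructor
  · obtain ⟨i, hi⟩ := Finite.exists_max fun i => ‖hH.eigenvalues i‖
    refine ⟨hH.eigenvalues i, (key _).2 ⟨i, rfl⟩, ?_⟩
    rw [hnorm]
    exact le_antisymm
      ((pi_norm_le_iff_of_nonneg (norm_nonneg _)).2 hi) (norm_le_pi_norm hH.eigenvalues i)
  · rintro r ⟨μ, hμ, rfl⟩
    obtain ⟨i, rfl⟩ := (key μ).1 hμ
    rw [hnorm]
    exact norm_le_pi_norm hH.eigenvalues i

theorem symToeplitz_isSymm (n : ℕ) (a : ℕ → ℝ) : (symToeplitz n a).IsSymm := by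
  ext j k
  simp only [symToeplitz, Matrix.transpose_apply, Matrix.of_apply]
  congr 1
  omega

/-! Testing the Toeplitz form against `cos (jθ)` and `sin (jθ)` gives `n‖T‖ ≥ ∑ N_d x_d cos (dθ)`,
where `N_d` counts the entries at distance `d` from the main diagonal. The norm thus dominates the
maximum over `θ` of a random cosine polynomial, which has order `√(n log n)`.

The norm is a seminorm of the first row. Convexity, centring and `𝔼|X_j| ≥ B` therefore replace
`X_j` by `ε_j a_j`, with Rademacher signs and any weights `|a_j| ≤ B`, at the cost of a factor 2
(`signAverage_le_two_mul_integral`). The weights are chosen to cancel `N_d` for `1 ≤ d ≤ m = ⌊n/2⌋`.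
At the `m` angles `2πk/(2m+1)` the cosine vectors have squared norm about `m/2` and inner products
`-1/2`. A second moment bound for exponentially tilted sums then shows that the maximum of the `m`
Rademacher sums has mean of order `√(m log m)` (`expect_ge_of_rademacher_sums`). -/

open MeasureTheory ProbabilityTheory
open scoped BigOperators

/-! ### Rademacher averages of seminorms and contraction -/

/-- The vector `x` with its coordinates multiplied by the signs `ε`. -/
def signMul {ι : Type*} (ε : ι → ℤˣ) (x : ι → ℝ) : ι → ℝ := fun i => ((ε i : ℤ) : ℝ) * x i

theorem signMul_mul {ι : Type*} (ε δ : ι → ℤˣ) (x : ι → ℝ) :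
    signMul (ε * δ) x = signMul ε (signMul δ x) := by
  funext i
  simp [signMul, mul_assoc]

theorem continuous_signMul {ι : Type*} (ε : ι → ℤˣ) : Continuous (signMul ε) := by
  unfold signMul
  fun_prop

/-- The Rademacher average of a seminorm at `x`: the mean of `p (ε x)` over all signs `ε`. -/
noncomputable def signAverage {ι : Type*} [Fintype ι] (p : Seminorm ℝ (ι → ℝ)) (x : ι → ℝ) :
    ℝ := by
  classical exact 𝔼 ε : ι → ℤˣ, p (signMul ε x)

section Seminorm

variable {ι : Type*} [Fintype ι] (p : Seminorm ℝ (ι → ℝ))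

theorem signAverage_signMul (δ : ι → ℤˣ) (x : ι → ℝ) :
    signAverage p (signMul δ x) = signAverage p x := by
  classical
  refine Fintype.expect_equiv (Equiv.mulRight δ) _ _ fun ε => ?_
  rw [← signMul_mul, Equiv.coe_mulRight]

theorem signAverage_abs (x : ι → ℝ) : signAverage p (fun i => |x i|) = signAverage p x := by
  rw [← signAverage_signMul p (fun i => if 0 ≤ x i then 1 else -1) x]
  congr 1
  funext i
  by_cases h : 0 ≤ x i
  · simp [signMul, h, abs_of_nonneg]
  · simp [signMul, h, abs_of_neg (not_le.1 h)]

theorem convexOn_signAverage : ConvexOn ℝ Set.univ (signAverage p) := by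
  classical
  refine ⟨convex_univ, fun x _ y _ a b ha hb hab => ?_⟩
  simp only [signAverage, smul_eq_mul, Finset.mul_expect]
  rw [← Finset.expect_add_distrib]
  refine Finset.expect_le_expect fun ε _ => ?_
  have h := p.convexOn.2 (Set.mem_univ (signMul ε x)) (Set.mem_univ (signMul ε y)) ha hb hab
  have e : signMul ε (a • x + b • y) = a • signMul ε x + b • signMul ε y := by
    funext i
    simp only [signMul, Pi.add_apply, Pi.smul_apply, smul_eq_mul]
    ring
  rw [e]
  exact h

/-- The contraction principle for Rademacher averages. -/
theorem signAverage_mono {a b : ι → ℝ} (hab : ∀ i, |a i| ≤ b i) :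
    signAverage p a ≤ signAverage p b := by
  -- A convex function on a box is dominated by its value at some vertex `(±b i)`, and the sign
  -- average takes the same value at all vertices.
  have hmem : a ∈ convexHull ℝ (Set.univ.pi fun i => ({-b i, b i} : Set ℝ)) := by
    refine mem_convexHull_pi fun i _ => ?_
    rw [convexHull_pair, segment_eq_Icc (by linarith [abs_nonneg (a i), hab i])]
    exact abs_le.1 (hab i)
  obtain ⟨y, hy, hle⟩ :=
    (convexOn_signAverage p).exists_ge_of_mem_convexHull (Set.subset_univ _) hmem
  refine hle.trans (le_of_eq ?_)
  rw [← signAverage_abs p y, ← signAverage_abs p b]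
  congr 1
  funext i
  have := hy i (Set.mem_univ i)
  simp only [Set.mem_insert_iff, Set.mem_singleton_iff] at this
  rcases this with h | h <;> simp [h]

theorem continuous_signAverage (hp : Continuous p) : Continuous (signAverage p) := by
  classical
  have : signAverage p = fun x => (∑ ε : ι → ℤˣ, p (signMul ε x)) / Fintype.card (ι → ℤˣ) := by
    funext x
    exact Fintype.expect_eq_sum_div_card _
  rw [this]
  exact (continuous_finsetSum _ fun ε _ => hp.comp (continuous_signMul ε)).div_const _

/-! ### Comparison of independent centred coordinates with signs -/

variable {p} {Ω : Type*} [MeasurableSpace Ω] {P : Measure Ω}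

theorem Seminorm.integrable_comp (hp : Continuous p) {Y : Ω → ι → ℝ} (hY : Integrable Y P) :
    Integrable (fun ω => p (Y ω)) P := by
  classical
  have hbound : ∀ x : ι → ℝ, p x ≤ (∑ i, p (Pi.single i 1)) * ‖x‖ := fun x => by
    have e : x = ∑ i, x i • (Pi.single i (1 : ℝ) : ι → ℝ) := by
      simpa using pi_eq_sum_univ' x
    calc p x = p (∑ i, x i • (Pi.single i (1 : ℝ) : ι → ℝ)) := by rw [← e]
      _ ≤ ∑ i, p (x i • (Pi.single i (1 : ℝ) : ι → ℝ)) :=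
          Finset.le_sum_of_subadditive p (map_zero p).le (map_add_le_add p) _ _
      _ ≤ ∑ i, p (Pi.single i 1) * ‖x‖ := by
          refine Finset.sum_le_sum fun i _ => ?_
          rw [map_smul_eq_mul, mul_comm]
          exact mul_le_mul_of_nonneg_left (norm_le_pi_norm x i) (apply_nonneg p _)
      _ = _ := by rw [Finset.sum_mul]
  refine (hY.norm.const_mul (∑ i, p (Pi.single i 1))).mono'
    (hp.comp_aestronglyMeasurable hY.1) (ae_of_all _ fun ω => ?_)
  rw [Real.norm_of_nonneg (apply_nonneg p _)]
  exact hbound _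

/-- Adding an independent centred vector does not decrease the mean of a seminorm. -/
theorem Seminorm.integral_le_integral_add_of_indepFun [IsProbabilityMeasure P] (hp : Continuous p)
    {U V : Ω → ι → ℝ} (hUm : Measurable U) (hVm : Measurable V) (hU : Integrable U P)
    (hV : Integrable V P) (hind : IndepFun U V P) (hV0 : ∫ ω, V ω ∂P = 0) :
    ∫ ω, p (U ω) ∂P ≤ ∫ ω, p (U ω + V ω) ∂P := by
  have hprod := (indepFun_iff_map_prod_eq_prod_map_map hUm.aemeasurable hVm.aemeasurable).1 hind
  have : IsProbabilityMeasure (P.map U) := Measure.isProbabilityMeasure_map hUm.aemeasurable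
  have : IsProbabilityMeasure (P.map V) := Measure.isProbabilityMeasure_map hVm.aemeasurable
  have hVid : Integrable (fun v : ι → ℝ => v) (P.map V) :=
    (integrable_map_measure aestronglyMeasurable_id hVm.aemeasurable).2 hV
  have hV0' : ∫ v, v ∂(P.map V) = 0 := by
    rw [integral_map hVm.aemeasurable (f := fun v => v) aestronglyMeasurable_id, hV0]
  have hcont : Continuous fun z : (ι → ℝ) × (ι → ℝ) => p (z.1 + z.2) :=
    hp.comp (continuous_fst.add continuous_snd)
  have hint : Integrable (fun z : (ι → ℝ) × (ι → ℝ) => p (z.1 + z.2))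
      ((P.map U).prod (P.map V)) := by
    rw [← hprod, integrable_map_measure hcont.aestronglyMeasurable
      (hUm.prodMk hVm).aemeasurable]
    exact Seminorm.integrable_comp hp (hU.add hV)
  -- Jensen's inequality in `v` for fixed `u`, since `u + v` has mean `u`.
  have hstep : ∀ u : ι → ℝ, p u ≤ ∫ v, p (u + v) ∂(P.map V) := fun u => by
    have hi : Integrable (fun v : ι → ℝ => u + v) (P.map V) := (integrable_const u).add hVid
    have h := p.convexOn.map_integral_le hp.continuousOn isClosed_univ
      (ae_of_all _ fun _ => Set.mem_univ _) hi (Seminorm.integrable_comp hp hi)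
    rwa [integral_add (integrable_const u) hVid, hV0', integral_const, probReal_univ, one_smul,
      add_zero] at h
  calc ∫ ω, p (U ω) ∂P = ∫ u, p u ∂(P.map U) :=
        (integral_map hUm.aemeasurable hp.aestronglyMeasurable).symm
    _ ≤ ∫ u, ∫ v, p (u + v) ∂(P.map V) ∂(P.map U) := by
        refine integral_mono ?_ hint.integral_prod_left hstep
        exact (integrable_map_measure hp.aestronglyMeasurable hUm.aemeasurable).2
          (Seminorm.integrable_comp hp hU)
    _ = ∫ z, p (z.1 + z.2) ∂((P.map U).prod (P.map V)) := (integral_prod _ hint).symm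
    _ = ∫ ω, p (U ω + V ω) ∂P := by
        rw [← hprod, integral_map (hUm.prodMk hVm).aemeasurable hcont.aestronglyMeasurable]

/-- The coordinates outside `S` form a centred vector independent of those in `S`, so restoring them
cannot lower the mean. -/
theorem Seminorm.integral_indicator_le [IsProbabilityMeasure P] [DecidableEq ι] (hp : Continuous p)
    {X : ι → Ω → ℝ} (hXm : ∀ i, Measurable (X i)) (hX : ∀ i, Integrable (X i) P)
    (hind : iIndepFun X P) (hX0 : ∀ i, ∫ ω, X i ω ∂P = 0) (S : Finset ι) :
    ∫ ω, p (fun i => if i ∈ S then X i ω else 0) ∂P ≤ ∫ ω, p (fun i => X i ω) ∂P := by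
  have hmeas : ∀ T : Finset ι, Measurable fun ω => fun i => if i ∈ T then X i ω else 0 := by
    intro T
    refine measurable_pi_lambda _ fun i => ?_
    by_cases h : i ∈ T <;> simp [h, hXm i]
  have hinteg : ∀ T : Finset ι, Integrable (fun ω => fun i => if i ∈ T then X i ω else 0) P := by
    intro T
    refine Integrable.of_eval fun i => ?_
    by_cases h : i ∈ T <;> simp [h, hX i]
  have hmask : ∀ T : Finset ι, Measurable fun (x : T → ℝ) (i : ι) =>
      if h : i ∈ T then x ⟨i, h⟩ else 0 := by
    intro T
    refine measurable_pi_lambda _ fun i => ?_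
    by_cases h : i ∈ T
    · simpa [h] using measurable_pi_apply _
    · simp [h]
  have hI : IndepFun (fun ω => fun i => if i ∈ S then X i ω else 0)
      (fun ω => fun i => if i ∈ Sᶜ then X i ω else 0) P := by
    have h := (hind.indepFun_finset S Sᶜ disjoint_compl_right hXm).comp (hmask S) (hmask Sᶜ)
    exact h
  have h0 : ∫ ω, (fun i => if i ∈ Sᶜ then X i ω else 0) ∂P = 0 := by
    funext i
    rw [eval_integral fun j => (hinteg Sᶜ).eval j]
    by_cases h : i ∈ S <;> simp [h, hX0 i]
  refine (Seminorm.integral_le_integral_add_of_indepFun hp (hmeas S) (hmeas Sᶜ) (hinteg S)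
    (hinteg Sᶜ) hI h0).trans (le_of_eq ?_)
  congr 1
  funext ω
  congr 1
  funext i
  by_cases h : i ∈ S <;> simp [h]

theorem Seminorm.integral_signMul_le [IsProbabilityMeasure P] (hp : Continuous p)
    {X : ι → Ω → ℝ} (hXm : ∀ i, Measurable (X i)) (hX : ∀ i, Integrable (X i) P)
    (hind : iIndepFun X P) (hX0 : ∀ i, ∫ ω, X i ω ∂P = 0) (ε : ι → ℤˣ) :
    ∫ ω, p (signMul ε fun i => X i ω) ∂P ≤ 2 * ∫ ω, p (fun i => X i ω) ∂P := by
  classical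
  have hinteg : ∀ T : Finset ι,
      Integrable (fun ω => p fun i => if i ∈ T then X i ω else 0) P := by
    intro T
    refine Seminorm.integrable_comp hp (Integrable.of_eval fun i => ?_)
    by_cases h : i ∈ T <;> simp [h, hX i]
  have hXi : Integrable (fun ω i => X i ω) P := Integrable.of_eval hX
  -- The signed vector is the restriction to `S` minus the restriction to `Sᶜ`; each contributes at
  -- most the full mean, whence the factor 2. No symmetry of the laws is needed.
  set S : Finset ι := Finset.univ.filter fun i => ε i = 1 with hS
  have hpt : ∀ ω, p (signMul ε fun i => X i ω) ≤
      p (fun i => if i ∈ S then X i ω else 0) + p (fun i => if i ∈ Sᶜ then X i ω else 0) := by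
    intro ω
    refine le_trans (le_of_eq ?_) (map_sub_le_add p _ _)
    congr 1
    funext i
    rcases Int.units_eq_one_or (ε i) with h | h <;> simp [signMul, hS, h]
  calc ∫ ω, p (signMul ε fun i => X i ω) ∂P
      ≤ ∫ ω, (p (fun i => if i ∈ S then X i ω else 0) +
          p (fun i => if i ∈ Sᶜ then X i ω else 0)) ∂P := by
        refine integral_mono (Seminorm.integrable_comp hp (Integrable.of_eval fun i => ?_))
          ((hinteg S).add (hinteg Sᶜ)) hpt
        exact (hX i).const_mul _
    _ = _ := integral_add (hinteg S) (hinteg Sᶜ)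
    _ ≤ _ := by
        linarith [Seminorm.integral_indicator_le hp hXm hX hind hX0 S,
          Seminorm.integral_indicator_le hp hXm hX hind hX0 Sᶜ]

/-- Comparison of independent centred coordinates with Rademacher signs. -/
theorem signAverage_le_two_mul_integral [IsProbabilityMeasure P] (hp : Continuous p)
    {X : ι → Ω → ℝ} (hXm : ∀ i, Measurable (X i)) (hX : ∀ i, Integrable (X i) P)
    (hind : iIndepFun X P) (hX0 : ∀ i, ∫ ω, X i ω ∂P = 0) {a : ι → ℝ}
    (ha : ∀ i, |a i| ≤ ∫ ω, |X i ω| ∂P) :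
    signAverage p a ≤ 2 * ∫ ω, p (fun i => X i ω) ∂P := by
  classical
  have habs : Integrable (fun ω i => |X i ω|) P := Integrable.of_eval fun i => (hX i).abs
  have hsig : ∀ ε : ι → ℤˣ, Integrable (fun ω => p (signMul ε fun i => X i ω)) P := fun ε =>
    Seminorm.integrable_comp hp (Integrable.of_eval fun i => (hX i).const_mul _)
  have havg : (fun ω => signAverage p fun i => X i ω) =
      fun ω => (∑ ε : ι → ℤˣ, p (signMul ε fun i => X i ω)) / Fintype.card (ι → ℤˣ) :=
    funext fun ω => Fintype.expect_eq_sum_div_card _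
  have hint : Integrable (fun ω => signAverage p fun i => X i ω) P := by
    rw [havg]
    exact (integrable_finsetSum _ fun ε _ => hsig ε).div_const _
  have hcard : (0 : ℝ) < Fintype.card (ι → ℤˣ) := by exact_mod_cast Fintype.card_pos
  calc signAverage p a ≤ signAverage p (fun i => ∫ ω, |X i ω| ∂P) := signAverage_mono p ha
    _ = signAverage p (∫ ω, (fun i => |X i ω|) ∂P) := by
        congr 1
        funext i
        rw [eval_integral fun j => habs.eval j]
    -- Jensen's inequality for the convex function `signAverage p`; the absolute values are then
    -- absorbed by the signs.
    _ ≤ ∫ ω, signAverage p (fun i => |X i ω|) ∂P := by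
        refine (convexOn_signAverage p).map_integral_le (continuous_signAverage p hp).continuousOn
          isClosed_univ (ae_of_all _ fun _ => Set.mem_univ _) habs ?_
        simpa only [Function.comp_def, signAverage_abs] using hint
    _ = ∫ ω, (∑ ε : ι → ℤˣ, p (signMul ε fun i => X i ω)) / Fintype.card (ι → ℤˣ) ∂P := by
        simp only [signAverage_abs, havg]
    _ = (∑ ε : ι → ℤˣ, ∫ ω, p (signMul ε fun i => X i ω) ∂P) / Fintype.card (ι → ℤˣ) := by
        rw [integral_div, integral_finsetSum _ fun ε _ => hsig ε]
    _ ≤ _ := by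
        rw [div_le_iff₀ hcard]
        refine (Finset.sum_le_card_nsmul _ _ _ fun ε _ =>
          Seminorm.integral_signMul_le hp hXm hX hind hX0 ε).trans (le_of_eq ?_)
        rw [nsmul_eq_mul, Finset.card_univ, mul_comm]

end Seminorm

/-! ### Exponential moments and maxima of Rademacher sums -/

/-- With `x = t²/2` and `s = x - x²`, one has `(1 - s) exp s ≤ 1`, while `(1 + x)(1 - s) = 1 + x³ ≥
1`; hence `exp s ≤ 1 + x ≤ cosh t`. -/
theorem Real.exp_le_cosh (t : ℝ) : Real.exp (t ^ 2 / 2 - t ^ 4 / 4) ≤ Real.cosh t := by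
  have h1 : 1 + t ^ 2 / 2 ≤ Real.cosh t := by
    have e : Real.cosh t = 1 + 2 * Real.sinh (t / 2) ^ 2 := by
      have := Real.cosh_two_mul (t / 2)
      rw [Real.cosh_sq, mul_div_cancel₀ t two_ne_zero] at this
      linarith
    have h : (t / 2) ^ 2 ≤ Real.sinh (t / 2) ^ 2 := by
      rw [sq_le_sq, Real.abs_sinh]
      exact Real.self_le_sinh_iff.2 (abs_nonneg _)
    rw [e]
    linarith
  refine le_trans ?_ h1
  have h2 := Real.add_one_le_exp (-(t ^ 2 / 2 - t ^ 4 / 4))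
  rw [Real.exp_neg] at h2
  have hpos := Real.exp_pos (t ^ 2 / 2 - t ^ 4 / 4)
  have h3 : (-(t ^ 2 / 2 - t ^ 4 / 4) + 1) * Real.exp (t ^ 2 / 2 - t ^ 4 / 4) ≤ 1 := by
    calc _ ≤ (Real.exp (t ^ 2 / 2 - t ^ 4 / 4))⁻¹ * Real.exp (t ^ 2 / 2 - t ^ 4 / 4) :=
          mul_le_mul_of_nonneg_right h2 hpos.le
      _ = 1 := inv_mul_cancel₀ hpos.ne'
  have h4 : (1 + t ^ 2 / 2) * ((-(t ^ 2 / 2 - t ^ 4 / 4) + 1) *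
      Real.exp (t ^ 2 / 2 - t ^ 4 / 4)) ≤ 1 + t ^ 2 / 2 := by
    have : 0 ≤ 1 + t ^ 2 / 2 := by positivity
    nlinarith
  have h5 : (1 + t ^ 2 / 2) * (-(t ^ 2 / 2 - t ^ 4 / 4) + 1) = 1 + t ^ 6 / 8 := by ring
  have h6 : 0 ≤ t ^ 6 / 8 * Real.exp (t ^ 2 / 2 - t ^ 4 / 4) := by positivity
  rw [← mul_assoc, h5] at h4
  linarith

section Rademacher

variable {ι : Type*} [Fintype ι] [DecidableEq ι]

theorem expect_exp_sum_signs (a : ι → ℝ) :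
    𝔼 ε : ι → ℤˣ, Real.exp (∑ i, ((ε i : ℤ) : ℝ) * a i) = ∏ i, Real.cosh (a i) := by
  have h := Finset.prod_univ_sum (fun _ : ι => (Finset.univ : Finset ℤˣ))
    fun i u => Real.exp (((u : ℤ) : ℝ) * a i)
  have h2 : ∀ i, ∑ u : ℤˣ, Real.exp (((u : ℤ) : ℝ) * a i) = 2 * Real.cosh (a i) := by
    intro i
    rw [Real.cosh_eq, UnitsInt.univ, Finset.sum_pair (by decide)]
    simp
    ring
  rw [Fintype.expect_eq_sum_div_card]
  simp only [Real.exp_sum]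
  rw [Fintype.piFinset_univ] at h
  rw [← h]
  simp only [h2]
  rw [Finset.prod_mul_distrib]
  simp

theorem expect_exp_sum_signs_le (a : ι → ℝ) :
    𝔼 ε : ι → ℤˣ, Real.exp (∑ i, ((ε i : ℤ) : ℝ) * a i) ≤ Real.exp ((∑ i, a i ^ 2) / 2) := by
  rw [expect_exp_sum_signs, Finset.sum_div, Real.exp_sum]
  exact Finset.prod_le_prod (fun i _ => (Real.cosh_pos _).le)
    fun i _ => Real.cosh_le_exp_half_sq _

theorem le_expect_exp_sum_signs (a : ι → ℝ) :
    Real.exp ((∑ i, a i ^ 2) / 2 - (∑ i, a i ^ 4) / 4) ≤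
      𝔼 ε : ι → ℤˣ, Real.exp (∑ i, ((ε i : ℤ) : ℝ) * a i) := by
  rw [expect_exp_sum_signs, Finset.sum_div, Finset.sum_div, ← Finset.sum_sub_distrib, Real.exp_sum]
  exact Finset.prod_le_prod (fun i _ => (Real.exp_pos _).le) fun i _ => Real.exp_le_cosh _

/-- A Paley–Zygmund inequality: if `S` has mean at least `m / 4` and second moment at most
`2 m ^ 2`, a nonnegative function that is at least `t` where `m / 8 ≤ S` has mean at least
`t / 128`. -/
theorem expect_ge_of_second_moment {κ : Type*} [Fintype κ] [Nonempty κ] {S g : κ → ℝ} {m t : ℝ}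
    (hm : 0 < m) (ht : 0 ≤ t) (h1 : m / 4 ≤ 𝔼 x, S x) (h2 : 𝔼 x, S x ^ 2 ≤ 2 * m ^ 2)
    (hg : ∀ x, 0 ≤ g x) (hgt : ∀ x, m / 8 ≤ S x → t ≤ g x) : t / 128 ≤ 𝔼 x, g x := by
  have hpt : ∀ x, t * (S x / (8 * m) - 1 / 64 - (S x ^ 2 / (256 * m ^ 2) -
      S x / (1024 * m) + 1 / 16384)) ≤ g x := by
    intro x
    -- `2u - u²` is at most 1 everywhere and at most 0 for `u ≤ 0`: a quadratic minorant of the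
    -- indicator of `m / 8 ≤ S`, whose mean is controlled by the first two moments alone.
    set u := (S x - m / 8) / (16 * m) with hu
    have e : S x / (8 * m) - 1 / 64 - (S x ^ 2 / (256 * m ^ 2) - S x / (1024 * m) + 1 / 16384)
        = 2 * u - u ^ 2 := by
      rw [hu]
      field_simp
      ring
    rw [e]
    by_cases h : m / 8 ≤ S x
    · exact (mul_le_of_le_one_right ht (by nlinarith [sq_nonneg (u - 1)])).trans (hgt x h)
    · have hneg : u ≤ 0 := div_nonpos_of_nonpos_of_nonneg (by linarith) (by linarith)
      exact (mul_nonpos_of_nonneg_of_nonpos ht (by nlinarith [sq_nonneg u])).trans (hg x)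
  refine le_trans ?_ (Finset.expect_le_expect fun x _ => hpt x)
  rw [← Finset.mul_expect, Finset.expect_sub_distrib, Finset.expect_sub_distrib,
    Finset.expect_add_distrib, Finset.expect_sub_distrib, Fintype.expect_const,
    Fintype.expect_const, ← Finset.expect_div, ← Finset.expect_div, ← Finset.expect_div,
    div_eq_mul_one_div]
  refine mul_le_mul_of_nonneg_left ?_ ht
  have h3 : (𝔼 x, S x ^ 2) / (256 * m ^ 2) ≤ 1 / 128 := by
    rw [div_le_iff₀ (by positivity)]
    linarith
  have h4 : 1 / 32 ≤ (𝔼 x, S x) / (8 * m) := by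
    rw [le_div_iff₀ (by positivity)]
    linarith
  have h5 : 1 / 4096 ≤ (𝔼 x, S x) / (1024 * m) := by
    rw [le_div_iff₀ (by positivity)]
    linarith
  linarith

/-- A lower bound for the mean of the maximum of `m` Rademacher sums whose coefficient vectors are
bounded, of squared norm comparable to `m`, and pairwise at nonacute angles. -/
theorem expect_ge_of_rademacher_sums {κ : Type*} [Fintype κ] {a : κ → ι → ℝ} {g : (ι → ℤˣ) → ℝ}
    (hκ : 2 ^ 48 ≤ Fintype.card κ) (ha : ∀ k i, |a k i| ≤ 1)
    (hlow : ∀ k, (Fintype.card κ : ℝ) / 4 ≤ ∑ i, a k i ^ 2)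
    (hup : ∀ k, ∑ i, a k i ^ 2 ≤ Fintype.card κ)
    (horth : ∀ k l, k ≠ l → ∑ i, a k i * a l i ≤ 0) (hg0 : ∀ ε, 0 ≤ g ε)
    (hg : ∀ k ε, ∑ i, ((ε i : ℤ) : ℝ) * a k i ≤ g ε) :
    Real.sqrt (Fintype.card κ * Real.log (Fintype.card κ)) / 2048 ≤ 𝔼 ε, g ε := by
  classical
  set m : ℝ := (Fintype.card κ : ℝ) with hm
  have hm48 : (2 : ℝ) ^ 48 ≤ m := by
    rw [hm]
    exact_mod_cast hκ
  have hm1 : 1 < m := lt_of_lt_of_le (by norm_num) hm48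
  have hm0 : 0 < m := by linarith
  have hlog : 0 < Real.log m := Real.log_pos hm1
  -- This tilt makes `exp (t² m) = m`, so the `m` diagonal terms of the second moment of `∑ V k`
  -- total at most `m²`, as do the off-diagonal ones.
  set t : ℝ := Real.sqrt (Real.log m / m) with ht
  have ht0 : 0 < t := Real.sqrt_pos.2 (by positivity)
  have htsq : t ^ 2 = Real.log m / m := Real.sq_sqrt (by positivity)
  have htm : t ^ 2 * m = Real.log m := by rw [htsq]; field_simp
  have hsqrt : Real.sqrt (m * Real.log m) = t * m := by
    rw [Real.sqrt_eq_iff_mul_self_eq (by positivity) (by positivity)]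
    linear_combination (-m) * htm
  set N : κ → ℝ := fun k => ∑ i, a k i ^ 2 with hN
  -- Normalised by the Gaussian bound for the exponential moment, so that `V k` and `V l` have
  -- product of mean at most 1 when the angle is nonacute.
  set V : κ → (ι → ℤˣ) → ℝ := fun k ε =>
    Real.exp (∑ i, ((ε i : ℤ) : ℝ) * (t * a k i) - t ^ 2 * N k / 2) with hV
  have hVV : ∀ k l, 𝔼 ε, V k ε * V l ε ≤ Real.exp (t ^ 2 * ∑ i, a k i * a l i) := by
    intro k l
    have e : ∀ ε, V k ε * V l ε =
        Real.exp (∑ i, ((ε i : ℤ) : ℝ) * (t * a k i + t * a l i)) *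
          Real.exp (-(t ^ 2 * N k / 2) - t ^ 2 * N l / 2) := by
      intro ε
      simp only [hV]
      rw [← Real.exp_add, ← Real.exp_add]
      congr 1
      simp only [mul_add, Finset.sum_add_distrib]
      ring
    simp only [e]
    rw [← Finset.expect_mul]
    refine (mul_le_mul_of_nonneg_right (expect_exp_sum_signs_le _) (Real.exp_pos _).le).trans
      (le_of_eq ?_)
    rw [← Real.exp_add]
    congr 1
    have : ∑ i, (t * a k i + t * a l i) ^ 2 =
        t ^ 2 * N k + t ^ 2 * N l + 2 * t ^ 2 * ∑ i, a k i * a l i := by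
      simp only [hN, Finset.mul_sum, ← Finset.sum_add_distrib]
      exact Finset.sum_congr rfl fun i _ => by ring
    rw [this]
    ring
  have hVmean : ∀ k, 1 / 4 ≤ 𝔼 ε, V k ε := by
    intro k
    have e : ∀ ε, V k ε = Real.exp (∑ i, ((ε i : ℤ) : ℝ) * (t * a k i)) *
        Real.exp (-(t ^ 2 * N k / 2)) := by
      intro ε
      simp only [hV]
      rw [← Real.exp_add]
      rfl
    simp only [e]
    rw [← Finset.expect_mul]
    refine le_trans ?_ (mul_le_mul_of_nonneg_right (le_expect_exp_sum_signs _) (Real.exp_pos _).le)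
    rw [← Real.exp_add]
    have e2 : ∑ i, (t * a k i) ^ 2 = t ^ 2 * N k := by
      simp only [hN, Finset.mul_sum]
      exact Finset.sum_congr rfl fun i _ => by ring
    -- The quartic loss in the exponent is then at most 1, and `1/4 ≤ exp (-1)`.
    have e4 : ∑ i, (t * a k i) ^ 4 ≤ 4 := by
      calc ∑ i, (t * a k i) ^ 4 ≤ ∑ i, t ^ 4 * a k i ^ 2 := by
            refine Finset.sum_le_sum fun i _ => ?_
            have h1 : a k i ^ 2 ≤ 1 := by
              rw [← sq_abs]
              exact pow_le_one₀ (abs_nonneg _) (ha k i)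
            have h2 : a k i ^ 4 ≤ a k i ^ 2 := by nlinarith [sq_nonneg (a k i)]
            rw [mul_pow]
            exact mul_le_mul_of_nonneg_left h2 (by positivity)
        _ = t ^ 4 * N k := by rw [← Finset.mul_sum]
        _ ≤ t ^ 4 * m := mul_le_mul_of_nonneg_left (hup k) (by positivity)
        _ = Real.log m ^ 2 / m := by
            rw [← htm]
            field_simp
        _ ≤ 4 := by
            have h1 : Real.log m ≤ 2 * Real.sqrt m := by
              have := Real.log_le_self (Real.sqrt_nonneg m)
              rw [Real.log_sqrt hm0.le] at this
              linarith
            rw [div_le_iff₀ hm0]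
            have := pow_le_pow_left₀ hlog.le h1 2
            rwa [mul_pow, Real.sq_sqrt hm0.le, show (2 : ℝ) ^ 2 = 4 by norm_num] at this
    rw [e2]
    have h3 : (1 : ℝ) / 4 ≤ Real.exp (-1) := by
      rw [Real.exp_neg, one_div]
      exact inv_anti₀ (Real.exp_pos 1) (by linarith [Real.exp_one_lt_d9])
    exact h3.trans (Real.exp_le_exp.2 (by linarith))
  have h1 : m / 4 ≤ 𝔼 ε, ∑ k, V k ε := by
    rw [Finset.expect_sum_comm]
    have := Finset.card_nsmul_le_sum Finset.univ _ _ fun k _ => hVmean k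
    rw [nsmul_eq_mul, Finset.card_univ] at this
    linarith
  have h2 : 𝔼 ε, (∑ k, V k ε) ^ 2 ≤ 2 * m ^ 2 := by
    have hkl : ∀ k l, 𝔼 ε, V k ε * V l ε ≤ 1 + if k = l then m else 0 := by
      intro k l
      refine (hVV k l).trans ?_
      by_cases h : k = l
      · subst h
        rw [if_pos rfl]
        have hle : t ^ 2 * ∑ i, a k i * a k i ≤ Real.log m := by
          rw [← htm]
          refine mul_le_mul_of_nonneg_left ?_ (sq_nonneg _)
          simpa only [← sq] using hup k
        have := Real.exp_le_exp.2 hle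
        rw [Real.exp_log hm0] at this
        linarith
      · rw [if_neg h, add_zero, Real.exp_le_one_iff]
        exact mul_nonpos_of_nonneg_of_nonpos (sq_nonneg _) (horth k l h)
    simp only [sq, Finset.sum_mul_sum]
    rw [Finset.expect_sum_comm]
    simp only [Finset.expect_sum_comm]
    refine (Finset.sum_le_sum fun k _ => Finset.sum_le_sum fun l _ => hkl k l).trans
      (le_of_eq ?_)
    simp only [Finset.sum_add_distrib, Finset.sum_const, Finset.sum_ite_eq, Finset.mem_univ,
      if_true, nsmul_eq_mul, Finset.card_univ, mul_one]
    rw [← hm]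
    ring
  have hconc := expect_ge_of_second_moment (S := fun ε => ∑ k, V k ε) (g := g) (m := m)
    (t := t * m / 16) hm0 (by positivity) h1 h2 hg0 ?_
  · rw [hsqrt]
    refine le_trans (le_of_eq ?_) hconc
    ring
  intro ε hε
  -- Taking logarithms, `t` times the `k`-th sum is at least `t² N k / 2 - log 8 ≥ log m / 8 - log m
  -- / 16`; the hypothesis `2 ^ 48 ≤ m` serves to absorb `log 8`.
  obtain ⟨k, hk⟩ : ∃ k, 1 / 8 ≤ V k ε := by
    by_contra! hcon
    have hne : (Finset.univ : Finset κ).Nonempty := by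
      rw [← Finset.card_pos, Finset.card_univ]
      omega
    have := Finset.sum_lt_sum_of_nonempty hne fun k _ => hcon k
    rw [Finset.sum_const, nsmul_eq_mul, Finset.card_univ, ← hm] at this
    linarith
  refine le_trans ?_ (hg k ε)
  have hk' := Real.log_le_log (by norm_num) hk
  simp only [hV] at hk'
  rw [Real.log_exp] at hk'
  have hY : ∑ i, ((ε i : ℤ) : ℝ) * (t * a k i) = t * ∑ i, ((ε i : ℤ) : ℝ) * a k i := by
    rw [Finset.mul_sum]
    exact Finset.sum_congr rfl fun i _ => by ring
  have hl8 : Real.log (1 / 8) = -(3 * Real.log 2) := by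
    rw [one_div, Real.log_inv, show (8 : ℝ) = 2 ^ 3 by norm_num, Real.log_pow]
    norm_num
  have hl48 : 48 * Real.log 2 ≤ Real.log m := by
    have := Real.log_le_log (by norm_num) hm48
    rw [Real.log_pow] at this
    exact_mod_cast this
  have hNk : t ^ 2 * (m / 4) ≤ t ^ 2 * N k := mul_le_mul_of_nonneg_left (hlow k) (sq_nonneg _)
  rw [hY, hl8] at hk'
  have hfin : t * (t * m / 16) ≤ t * ∑ i, ((ε i : ℤ) : ℝ) * a k i := by
    have : t * (t * m / 16) = Real.log m / 16 := by rw [← htm]; ring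
    rw [this]
    have : t ^ 2 * (m / 4) = Real.log m / 4 := by rw [← htm]; ring
    linarith
  exact le_of_mul_le_mul_left hfin ht0

end Rademacher

/-! ### Near-orthogonality of cosine vectors -/

theorem sum_cos_mul_two_sin_half (x : ℝ) (m : ℕ) :
    (∑ d ∈ Finset.Icc 1 m, Real.cos (d * x)) * (2 * Real.sin (x / 2)) =
      Real.sin (m * x + x / 2) - Real.sin (x / 2) := by
  induction m with
  | zero => simp
  | succ m ih =>
    rw [Finset.sum_Icc_succ_top (by omega), add_mul, ih]
    have h2 : (m : ℝ) * x + x / 2 = ((m + 1 : ℕ) : ℝ) * x - x / 2 := by push_cast; ring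
    rw [h2, Real.sin_add, Real.sin_sub]
    ring

/-- At these angles the upper end of the telescoped sum is `sin (rπ) = 0`. The odd denominator makes
every off-diagonal inner product below equal to `-1/2`, hence nonpositive. -/
theorem sum_cos_two_pi_div {m : ℕ} {r : ℤ} (hr0 : r ≠ 0) (hr : |r| < 2 * m + 1) :
    ∑ d ∈ Finset.Icc 1 m, Real.cos (d * (2 * Real.pi * r / (2 * m + 1))) = -1 / 2 := by
  have hN : (2 * m + 1 : ℝ) ≠ 0 := by positivity
  have h := sum_cos_mul_two_sin_half (2 * Real.pi * r / (2 * m + 1)) m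
  have e : (m : ℝ) * (2 * Real.pi * r / (2 * m + 1)) + 2 * Real.pi * r / (2 * m + 1) / 2 =
      r * Real.pi := by
    field_simp
  rw [e, Real.sin_int_mul_pi] at h
  have hs : Real.sin (2 * Real.pi * r / (2 * m + 1) / 2) ≠ 0 := by
    rw [Ne, Real.sin_eq_zero_iff]
    rintro ⟨q, hq⟩
    have hq' : (2 * m + 1 : ℝ) * q = r := by
      field_simp at hq
      linarith
    have hdvd : (2 * m + 1 : ℤ) ∣ r := ⟨q, by exact_mod_cast hq'.symm⟩
    exact hr0 (Int.eq_zero_of_abs_lt_dvd hdvd hr)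
  have := mul_right_cancel₀ hs (show (2 * ∑ d ∈ Finset.Icc 1 m,
    Real.cos (d * (2 * Real.pi * r / (2 * m + 1)))) * _ = (-1) * _ by linarith)
  linarith

theorem sum_cos_mul_cos_two_pi_div {m : ℕ} {k l : ℕ} (hk : 0 < k) (hkm : k ≤ m) (hl : 0 < l)
    (hlm : l ≤ m) :
    ∑ d ∈ Finset.Icc 1 m, Real.cos (d * (2 * Real.pi * k / (2 * m + 1))) *
      Real.cos (d * (2 * Real.pi * l / (2 * m + 1))) =
        if k = l then (m : ℝ) / 2 - 1 / 4 else -1 / 2 := by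
  have e : ∀ d : ℕ, Real.cos (d * (2 * Real.pi * k / (2 * m + 1))) *
      Real.cos (d * (2 * Real.pi * l / (2 * m + 1))) =
      (Real.cos (d * (2 * Real.pi * ((k - l : ℤ) : ℝ) / (2 * m + 1))) +
        Real.cos (d * (2 * Real.pi * ((k + l : ℤ) : ℝ) / (2 * m + 1)))) / 2 := by
    intro d
    have h1 : (d : ℝ) * (2 * Real.pi * ((k - l : ℤ) : ℝ) / (2 * m + 1)) =
      d * (2 * Real.pi * k / (2 * m + 1)) - d * (2 * Real.pi * l / (2 * m + 1)) := by
      push_cast; ring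
    have h2 : (d : ℝ) * (2 * Real.pi * ((k + l : ℤ) : ℝ) / (2 * m + 1)) =
      d * (2 * Real.pi * k / (2 * m + 1)) + d * (2 * Real.pi * l / (2 * m + 1)) := by
      push_cast; ring
    rw [h1, h2, Real.cos_sub, Real.cos_add]
    ring
  have hadd := sum_cos_two_pi_div (m := m) (r := (k + l : ℤ)) (by omega)
    (by rw [abs_lt]; omega)
  simp only [e]
  rw [← Finset.sum_div, Finset.sum_add_distrib, hadd]
  split_ifs with h
  · subst h
    simp
    ring
  · rw [sum_cos_two_pi_div (m := m) (r := (k - l : ℤ)) (by omega) (by rw [abs_lt]; omega)]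
    ring

theorem sum_fin_ite_Icc {n m : ℕ} (hmn : m < n) (f : ℕ → ℝ) :
    ∑ i : Fin n, (if (i : ℕ) ∈ Finset.Icc 1 m then f i else 0) = ∑ d ∈ Finset.Icc 1 m, f d := by
  rw [Fin.sum_univ_eq_sum_range (fun d => if d ∈ Finset.Icc 1 m then f d else 0),
    Finset.sum_ite_mem]
  congr 1
  ext d
  simp only [Finset.mem_inter, Finset.mem_range, Finset.mem_Icc]
  omega

/-! ### The Toeplitz norm as a seminorm and its trigonometric lower bound -/

/-- The distance of two indices, as an index. -/
def absDiff {n : ℕ} (j k : Fin n) : Fin n := ⟨((j : ℤ) - (k : ℤ)).natAbs, by omega⟩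

/-- The symmetric Toeplitz matrix as a linear function of its first row. -/
noncomputable def toeplitzCLM (n : ℕ) :
    (Fin n → ℝ) →ₗ[ℝ] (EuclideanSpace ℝ (Fin n) →L[ℝ] EuclideanSpace ℝ (Fin n)) where
  toFun x := Matrix.toEuclideanCLM (n := Fin n) (𝕜 := ℝ) (Matrix.of fun j k => x (absDiff j k))
  map_add' x y := by
    rw [← map_add]
    rfl
  map_smul' c x := by
    rw [RingHom.id_apply, ← map_smul]
    rfl

/-- The spectral norm of a symmetric Toeplitz matrix as a seminorm of its first row. -/
noncomputable def toeplitzSeminorm (n : ℕ) : Seminorm ℝ (Fin n → ℝ) :=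
  (normSeminorm ℝ _).comp (toeplitzCLM n)

theorem toeplitzSeminorm_apply {n : ℕ} (x : Fin n → ℝ) :
    toeplitzSeminorm n x = specNorm (Matrix.of fun j k => x (absDiff j k)) := rfl

theorem specNorm_symToeplitz (n : ℕ) (a : ℕ → ℝ) :
    specNorm (symToeplitz n a) = toeplitzSeminorm n fun i => a i := rfl

theorem continuous_toeplitzSeminorm (n : ℕ) : Continuous (toeplitzSeminorm n) :=
  continuous_norm.comp (toeplitzCLM n).continuous_of_finiteDimensional

theorem dotProduct_mulVec_le_specNorm {n : ℕ} (A : Matrix (Fin n) (Fin n) ℝ) (u v : Fin n → ℝ) :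
    ∑ j, ∑ k, u j * A j k * v k ≤
      specNorm A * (‖WithLp.toLp 2 u‖ * ‖WithLp.toLp 2 v‖) := by
  have e : ∑ j, ∑ k, u j * A j k * v k = inner ℝ (WithLp.toLp 2 u)
      (Matrix.toEuclideanCLM (n := Fin n) (𝕜 := ℝ) A (WithLp.toLp 2 v)) := by
    rw [Matrix.toEuclideanCLM_toLp, PiLp.inner_apply]
    refine Finset.sum_congr rfl fun j _ => ?_
    simp only [Matrix.mulVec, dotProduct, RCLike.inner_apply, conj_trivial, Finset.sum_mul]
    exact Finset.sum_congr rfl fun k _ => by ring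
  rw [e]
  refine (real_inner_le_norm _ _).trans ?_
  have := (Matrix.toEuclideanCLM (n := Fin n) (𝕜 := ℝ) A).le_opNorm (WithLp.toLp 2 v)
  calc _ ≤ ‖WithLp.toLp 2 u‖ * (specNorm A * ‖WithLp.toLp 2 v‖) :=
        mul_le_mul_of_nonneg_left this (norm_nonneg _)
    _ = _ := by ring

theorem abs_entry_le_specNorm {n : ℕ} (A : Matrix (Fin n) (Fin n) ℝ) (j k : Fin n) :
    |A j k| ≤ specNorm A := by
  have h : ‖Matrix.toEuclideanCLM (n := Fin n) (𝕜 := ℝ) A (EuclideanSpace.single k 1)‖ ≤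
      specNorm A := by
    simpa [specNorm] using (Matrix.toEuclideanCLM (n := Fin n) (𝕜 := ℝ) A).le_opNorm
      (EuclideanSpace.single k 1)
  refine le_trans ?_ ((PiLp.norm_apply_le _ j).trans h)
  simp [EuclideanSpace.single]

/-- Expanding `cos ((j - k)θ)` gives the quadratic forms of a cosine and a sine vector, whose
squared norms add up to exactly `n`. -/
theorem sum_mul_cos_le_specNorm {n : ℕ} (A : Matrix (Fin n) (Fin n) ℝ) (θ : ℝ) :
    ∑ j : Fin n, ∑ k : Fin n, A j k * Real.cos (((j : ℝ) - k) * θ) ≤ n * specNorm A := by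
  have hc := dotProduct_mulVec_le_specNorm A (fun j => Real.cos (j * θ)) fun j => Real.cos (j * θ)
  have hs := dotProduct_mulVec_le_specNorm A (fun j => Real.sin (j * θ)) fun j => Real.sin (j * θ)
  rw [← sq, EuclideanSpace.norm_sq_eq] at hc hs
  simp only [Real.norm_eq_abs, sq_abs] at hc hs
  have e : ∑ j : Fin n, Real.cos (j * θ) ^ 2 + ∑ j : Fin n, Real.sin (j * θ) ^ 2 = n := by
    rw [← Finset.sum_add_distrib]
    simp
  calc ∑ j : Fin n, ∑ k : Fin n, A j k * Real.cos (((j : ℝ) - k) * θ)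
      = ∑ j : Fin n, ∑ k : Fin n, Real.cos (j * θ) * A j k * Real.cos (k * θ) +
        ∑ j : Fin n, ∑ k : Fin n, Real.sin (j * θ) * A j k * Real.sin (k * θ) := by
        simp only [← Finset.sum_add_distrib, sub_mul, Real.cos_sub]
        exact Finset.sum_congr rfl fun j _ => Finset.sum_congr rfl fun k _ => by ring
    _ ≤ specNorm A * (∑ j : Fin n, Real.cos (j * θ) ^ 2 + ∑ j : Fin n, Real.sin (j * θ) ^ 2) := by
        rw [mul_add]
        exact add_le_add hc hs
    _ = n * specNorm A := by rw [e, mul_comm]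

/-- The number of entries of an `n × n` matrix on the two diagonals at distance `d` from the
main one. -/
def diagonalCard {n : ℕ} (d : Fin n) : ℕ :=
  (Finset.univ.filter fun q : Fin n × Fin n => absDiff q.1 q.2 = d).card

/-- Only the pairs `(j, j + d)` on one side are counted, which also covers `d = 0`. -/
theorem sub_le_diagonalCard {n : ℕ} (d : Fin n) : n - d ≤ diagonalCard d := by
  rw [← Fintype.card_fin (n - d), ← Finset.card_univ]
  refine Finset.card_le_card_of_injOn
    (fun j : Fin (n - d) => ((⟨j, by omega⟩ : Fin n), (⟨j + d, by omega⟩ : Fin n))) ?_ ?_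
  · intro j _
    simp only [Finset.coe_filter, Finset.mem_univ, true_and, Set.mem_ofPred_eq, absDiff, Fin.ext_iff]
    push_cast
    omega
  · intro i _ j _ h
    simp only [Prod.mk.injEq, Fin.mk.injEq] at h
    exact Fin.ext h.1

theorem sum_diagonalCard_mul_cos_le {n : ℕ} (x : Fin n → ℝ) (θ : ℝ) :
    ∑ d : Fin n, diagonalCard d * x d * Real.cos (d * θ) ≤ n * toeplitzSeminorm n x := by
  rw [toeplitzSeminorm_apply]
  refine le_trans (le_of_eq ?_) (sum_mul_cos_le_specNorm _ θ)
  rw [← Finset.sum_product', Finset.univ_product_univ,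
    ← Finset.sum_fiberwise _ fun q : Fin n × Fin n => absDiff q.1 q.2]
  refine Finset.sum_congr rfl fun d _ => ?_
  rw [diagonalCard, mul_assoc, ← nsmul_eq_mul, ← Finset.sum_const]
  refine Finset.sum_congr rfl fun q hq => ?_
  simp only [Finset.mem_filter, Finset.mem_univ, true_and] at hq
  subst hq
  rw [Matrix.of_apply]
  congr 1
  have e : (((absDiff q.1 q.2 : Fin n) : ℕ) : ℝ) = |(q.1 : ℝ) - q.2| := by
    simp [absDiff, Nat.cast_natAbs]
  rw [e]
  rcases abs_choice ((q.1 : ℝ) - q.2) with h | h <;> rw [h]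
  rw [neg_mul, Real.cos_neg]

/-- The expected spectral norm of a Rademacher Toeplitz matrix, with entries damped by suitable
weights bounded by `B`, is at least of order `√(m log m)`, where `m = ⌊n / 2⌋`. -/
theorem exists_weights_signAverage_toeplitz_ge {B : ℝ} (hB : 0 < B) {n : ℕ} (hn : 2 ^ 49 ≤ n) :
    ∃ a : Fin n → ℝ, (∀ i, |a i| ≤ B) ∧
      B / 4096 * Real.sqrt ((n / 2 : ℕ) * Real.log (n / 2 : ℕ)) ≤
        signAverage (toeplitzSeminorm n) a := by
  classical
  set m := n / 2 with hm
  have hmn : m < n := by omega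
  have hm48 : 2 ^ 48 ≤ m := by omega
  have hn0 : (0 : ℝ) < n := by exact_mod_cast (by omega : 0 < n)
  -- The weights make `diagonalCard i * a i` equal to `B n / 2` on `1 ≤ i ≤ m`. They stay below `B`
  -- because diagonals this close to the main one have at least `n / 2` entries.
  set a : Fin n → ℝ := fun i =>
    if (i : ℕ) ∈ Finset.Icc 1 m then B * n / (2 * diagonalCard i) else 0 with ha
  have hdiag : ∀ i : Fin n, (i : ℕ) ∈ Finset.Icc 1 m → (n : ℝ) ≤ 2 * diagonalCard i := by
    intro i hi
    rw [Finset.mem_Icc] at hi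
    have := sub_le_diagonalCard i
    exact_mod_cast (by omega : n ≤ 2 * diagonalCard i)
  refine ⟨a, fun i => ?_, ?_⟩
  · simp only [ha]
    split_ifs with h
    · have h1 := hdiag i h
      rw [abs_of_nonneg (by positivity), div_le_iff₀ (by linarith)]
      exact mul_le_mul_of_nonneg_left h1 hB.le
    · simpa using hB.le
  -- The shift to `k + 1` makes the frequencies run over `1, …, m`, so that sums and differences of
  -- distinct ones are nonzero and less than `2m + 1` in absolute value.
  set b : Fin m → Fin n → ℝ := fun k i =>
    if (i : ℕ) ∈ Finset.Icc 1 m then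
      Real.cos ((i : ℕ) * (2 * Real.pi * ((k + 1 : ℕ) : ℝ) / (2 * m + 1))) else 0 with hb
  have hinner : ∀ k l : Fin m, ∑ i, b k i * b l i =
      if k = l then (m : ℝ) / 2 - 1 / 4 else -1 / 2 := by
    intro k l
    have h := sum_cos_mul_cos_two_pi_div (m := m) (k := k + 1) (l := l + 1) (by omega) (by omega)
      (by omega) (by omega)
    simp only [add_left_inj, ← Fin.ext_iff] at h
    rw [← h, ← sum_fin_ite_Icc hmn]
    refine Finset.sum_congr rfl fun i _ => ?_
    simp only [hb]
    split_ifs <;> simp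
  have hm1 : (1 : ℝ) ≤ m := by exact_mod_cast (by omega : 1 ≤ m)
  have hsq : ∀ k : Fin m, ∑ i, b k i ^ 2 = (m : ℝ) / 2 - 1 / 4 := by
    intro k
    simpa [sq] using hinner k k
  have key := expect_ge_of_rademacher_sums (κ := Fin m) (a := b)
    (g := fun ε => 2 / B * toeplitzSeminorm n (signMul ε a)) (by simpa using hm48) ?_ ?_ ?_ ?_ ?_ ?_
  · rw [← Finset.mul_expect, Fintype.card_fin] at key
    have h := mul_le_mul_of_nonneg_left key (by positivity : 0 ≤ B / 2)
    have e : B / 2 * (2 / B * 𝔼 ε : Fin n → ℤˣ, toeplitzSeminorm n (signMul ε a)) =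
        𝔼 ε : Fin n → ℤˣ, toeplitzSeminorm n (signMul ε a) := by
      field_simp
    rw [e] at h
    refine le_trans (le_of_eq ?_) (h.trans (le_of_eq ?_))
    · ring
    · unfold signAverage
      congr!
  · intro k i
    simp only [hb]
    split_ifs
    · exact Real.abs_cos_le_one _
    · simp
  · intro k
    rw [hsq, Fintype.card_fin]
    linarith
  · intro k
    rw [hsq, Fintype.card_fin]
    linarith
  · intro k l hkl
    rw [hinner, if_neg hkl]
    norm_num
  · intro ε
    have := apply_nonneg (toeplitzSeminorm n) (signMul ε a)
    positivity
  · intro k ε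
    have h := sum_diagonalCard_mul_cos_le (signMul ε a)
      (2 * Real.pi * ((k + 1 : ℕ) : ℝ) / (2 * m + 1))
    have e : ∑ d : Fin n, diagonalCard d * signMul ε a d *
        Real.cos ((d : ℕ) * (2 * Real.pi * ((k + 1 : ℕ) : ℝ) / (2 * m + 1))) =
        n * B / 2 * ∑ i, ((ε i : ℤ) : ℝ) * b k i := by
      rw [Finset.mul_sum]
      refine Finset.sum_congr rfl fun i _ => ?_
      simp only [signMul, ha, hb]
      split_ifs with hi
      · have : (0 : ℝ) < diagonalCard i := by linarith [hdiag i hi]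
        field_simp
      · simp
    rw [e] at h
    have h2 : n * (B / 2 * ∑ i, ((ε i : ℤ) : ℝ) * b k i) ≤
        n * toeplitzSeminorm n (signMul ε a) := by linarith
    have h3 := le_of_mul_le_mul_left h2 hn0
    have h4 := mul_le_mul_of_nonneg_left h3 (by positivity : 0 ≤ 2 / B)
    refine le_trans (le_of_eq ?_) h4
    field_simp

/-! ### Passage from `⌊n/2⌋` to `n` and conclusion -/

/-- From `n ≤ 3⌊n/2⌋` and `n ≤ ⌊n/2⌋²` the radicand grows by a factor of at most 6, rounded up to 9.
-/
theorem sqrt_mul_log_le_half {n : ℕ} (hn : 2 ^ 49 ≤ n) :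
    Real.sqrt (n * Real.log n) ≤ 3 * Real.sqrt ((n / 2 : ℕ) * Real.log (n / 2 : ℕ)) := by
  have h1 : n ≤ 3 * (n / 2) := by omega
  have h2 : n ≤ (n / 2) ^ 2 := by
    have : 3 ≤ n / 2 := by omega
    nlinarith
  have h1' : (n : ℝ) ≤ 3 * (n / 2 : ℕ) := by exact_mod_cast h1
  have h2' : (n : ℝ) ≤ ((n / 2 : ℕ) : ℝ) ^ 2 := by exact_mod_cast h2
  have hn1 : (1 : ℝ) ≤ n := by exact_mod_cast (by omega : 1 ≤ n)
  have hl : Real.log n ≤ 2 * Real.log (n / 2 : ℕ) := by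
    have := Real.log_le_log (by linarith) h2'
    rwa [Real.log_pow] at this
  have hl0 : 0 ≤ Real.log n := Real.log_nonneg hn1
  rw [show (3 : ℝ) = Real.sqrt 9 by rw [show (9 : ℝ) = 3 ^ 2 by norm_num]; simp,
    ← Real.sqrt_mul (by norm_num)]
  refine Real.sqrt_le_sqrt ?_
  have := mul_le_mul h1' hl hl0 (by positivity)
  have h0 : 0 ≤ ((n / 2 : ℕ) : ℝ) * Real.log (n / 2 : ℕ) := by
    have : 0 ≤ Real.log (n / 2 : ℕ) := by linarith
    positivity
  linarith

theorem sqrt_mul_log_le_self (n : ℕ) : Real.sqrt (n * Real.log n) ≤ n := by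
  rw [Real.sqrt_le_left (by positivity), sq]
  exact mul_le_mul_of_nonneg_left (Real.log_le_self (by positivity)) (by positivity)

theorem theorem3 (B : ℝ) (hB : 0 < B) :
    ∃ c : ℝ, 0 < c ∧
      ∀ {Ω : Type*} [MeasurableSpace Ω] (P : MeasureTheory.Measure Ω)
        [MeasureTheory.IsProbabilityMeasure P] (X : ℕ → Ω → ℝ),
        (∀ j, Measurable (X j)) →
        ProbabilityTheory.iIndepFun X P →
        (∀ j, ∫ ω, X j ω ∂P = 0) →
        (∀ j, ∫ ω, (X j ω) ^ 2 ∂P = 1) →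
        (∀ j, B ≤ ∫ ω, |X j ω| ∂P) →
        ∀ n : ℕ, 2 ≤ n →
          MeasureTheory.Integrable (fun ω => specNorm (symToeplitz n fun j => X j ω)) P ∧
          c * Real.sqrt (n * Real.log n) ≤
            ∫ ω, specNorm (symToeplitz n fun j => X j ω) ∂P := by
  -- The constant is dictated by `n < 2 ^ 49`, where `√(n log n) ≤ n`; large `n` would allow `B / (3
  -- * 4096 * 2)`.
  refine ⟨B / 2 ^ 49, by positivity, ?_⟩
  intro Ω _ P _ X hXm hind hX0 hX2 hXB n hn
  -- A nonintegrable function has Bochner integral 0, so second moment 1 forces square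
  -- integrability.
  have hX : ∀ j, Integrable (X j) P := fun j =>
    ((memLp_two_iff_integrable_sq (hXm j).aestronglyMeasurable).2
      (Integrable.of_integral_ne_zero (by rw [hX2 j]; exact one_ne_zero))).integrable one_le_two
  have hint : Integrable (fun ω => specNorm (symToeplitz n fun j => X j ω)) P := by
    simp only [specNorm_symToeplitz]
    exact Seminorm.integrable_comp (continuous_toeplitzSeminorm n)
      (Integrable.of_eval fun i : Fin n => hX i)
  refine ⟨hint, ?_⟩
  rcases lt_or_ge n (2 ^ 49) with hsmall | hlarge
  -- For small `n` a single entry, of mean absolute value at least `B`, suffices.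
  · have h1 : ∫ ω, |X 1 ω| ∂P ≤ ∫ ω, specNorm (symToeplitz n fun j => X j ω) ∂P :=
      integral_mono (hX 1).abs hint fun ω => by
        simpa [symToeplitz] using abs_entry_le_specNorm (symToeplitz n fun j => X j ω)
          ⟨1, by omega⟩ ⟨0, by omega⟩
    refine le_trans ?_ ((hXB 1).trans h1)
    have h2 : Real.sqrt (n * Real.log n) ≤ 2 ^ 49 :=
      (sqrt_mul_log_le_self n).trans (by exact_mod_cast hsmall.le)
    rw [div_mul_eq_mul_div, div_le_iff₀ (by positivity)]
    exact mul_le_mul_of_nonneg_left h2 hB.le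
  · obtain ⟨a, haB, ha⟩ := exists_weights_signAverage_toeplitz_ge hB hlarge
    have h1 := signAverage_le_two_mul_integral (P := P) (continuous_toeplitzSeminorm n)
      (X := fun (i : Fin n) => X i) (fun i => hXm i) (fun i => hX i)
      (hind.precomp Fin.val_injective) (fun i => hX0 i) (a := a) fun i => (haB i).trans (hXB i)
    have h2 := mul_le_mul_of_nonneg_left (sqrt_mul_log_le_half hlarge)
      (by positivity : 0 ≤ B / (3 * 4096 * 2))
    have h3 : B / 2 ^ 49 * Real.sqrt (n * Real.log n) ≤
        B / (3 * 4096 * 2) * Real.sqrt (n * Real.log n) := by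
      refine mul_le_mul_of_nonneg_right ?_ (Real.sqrt_nonneg _)
      exact div_le_div_of_nonneg_left hB.le (by norm_num) (by norm_num)
    simp only [specNorm_symToeplitz]
    linarith
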